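/- For $c,d>0$ let $B(c,d)=\dfrac{\Gamma(c)\Gamma(d)}{\Gamma(c+d)}$, let $F(c,d;c+d;x)=\sum_{n=0}^{\infty}\dfrac{(c)_n (d)_n}{(c+d)_n}\dfrac{x^n}{n!}$ for $|x|<1$, where $(a)_0=1$ and $(a)_n=a(a+1)\cdots(a+n-1)$ for $n\ge 1$, and put $$g(x)=x\,F(c,d;c+d;x)\quad (0<x<1),\qquad Q_g(x,y)=\frac{g(x)+g(y)}{g(x+y-xy)}\quad (0<x,y<1).$$ (1) If $cd\le 1$, then $1\le Q_g(x,y)$ for all $x,y\in(0,1)$; if moreover $(c,d)\ne(1,1)$, then $$1\le Q_g(x,y)<\min\{B(c,d),2\}\qquad\text{for all } x,y\in(0,1).$$ (2) If $\dfrac1c+\dfrac1d\le 2$, then $Q_g(x,y)\le 1$ for all $x,y\in(0,1)$; if moreover $(c,d)\ne(1,1)$, then $$B(c,d)<Q_g(x,y)\le 1\qquad\text{for all } x,y\in(0,1).$$ (In the excluded case $c=d=1$ one has $B(1,1)=1$, and the two non-strict bounds say that $Q_g(x,y)=1$ for all $x,y\in(0,1)$.) -/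

import Mathlib

/-- `g(x) = x F(c,d;c+d;x)`, with `F` the Gaussian hypergeometric function of Mathlib. -/
noncomputable def zeroBalancedG (c d x : ℝ) : ℝ :=
  x * ordinaryHypergeometric c d (c + d) x

/-- `Q_g(x,y) = (g(x) + g(y)) / g(x + y - xy)`. -/
noncomputable def quotientQ (g : ℝ → ℝ) (x y : ℝ) : ℝ :=
  (g x + g y) / g (x + y - x * y)

open Filter Topology

/-! With z = x + y - xy, the function L(x) = -log(1 - x) satisfies L(z) = L(x) + L(y), so its
quotient is 1. Write g as the series of L with weights r n, where r 0 = 1 and r n → 1/B. If r is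
monotone, g/L is monotone in the same sense (`hasSum_mul_le_of_cross`); comparing x and y with z
gives the bound 1. Moreover g lies strictly between L and L/B once r is not constant, which gives
the bound B; the bound 2 only uses that g increases. Monotonicity of r is read off
`zeroBalancedRatio_succ`. -/

/-- Chebyshev-type rearrangement inequality for two oppositely related pairs of sequences. -/
theorem sum_mul_sum_le_of_cross {a b p q : ℕ → ℝ}
    (hab : ∀ i j, i ≤ j → a j * b i ≤ a i * b j)
    (hpq : ∀ i j, i ≤ j → p j * q i ≤ p i * q j) (s : Finset ℕ) :
    (∑ i ∈ s, a i * q i) * (∑ i ∈ s, b i * p i) ≤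
      (∑ i ∈ s, a i * p i) * (∑ i ∈ s, b i * q i) := by
  -- Both factors have the same sign for every pair (i, j); expanding gives twice the desired
  -- difference.
  have key : 0 ≤ ∑ i ∈ s, ∑ j ∈ s, (a i * b j - a j * b i) * (p i * q j - p j * q i) := by
    refine Finset.sum_nonneg fun i _ => Finset.sum_nonneg fun j _ => ?_
    rcases le_total i j with h | h
    · exact mul_nonneg (sub_nonneg.2 (hab i j h)) (sub_nonneg.2 (hpq i j h))
    · exact mul_nonneg_of_nonpos_of_nonpos (sub_nonpos.2 (hab j i h)) (sub_nonpos.2 (hpq j i h))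
  have expand : ∑ i ∈ s, ∑ j ∈ s, (a i * b j - a j * b i) * (p i * q j - p j * q i) =
      2 * ((∑ i ∈ s, a i * p i) * (∑ i ∈ s, b i * q i) -
        (∑ i ∈ s, a i * q i) * (∑ i ∈ s, b i * p i)) := by
    have h (i j : ℕ) : (a i * b j - a j * b i) * (p i * q j - p j * q i) =
        (a i * p i) * (b j * q j) - (a i * q i) * (b j * p j) +
          ((b i * q i) * (a j * p j) - (b i * p i) * (a j * q j)) := by ring
    simp_rw [h, Finset.sum_add_distrib, Finset.sum_sub_distrib, ← Finset.sum_mul_sum]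
    ring
  linarith

/-- Monotone ratio rule for series (Biernacki and Krzyż). -/
theorem hasSum_mul_le_of_cross {a b p q : ℕ → ℝ} {Ap Aq Bp Bq : ℝ}
    (hab : ∀ i j, i ≤ j → a j * b i ≤ a i * b j)
    (hpq : ∀ i j, i ≤ j → p j * q i ≤ p i * q j)
    (hAp : HasSum (fun i => a i * p i) Ap) (hAq : HasSum (fun i => a i * q i) Aq)
    (hBp : HasSum (fun i => b i * p i) Bp) (hBq : HasSum (fun i => b i * q i) Bq) :
    Aq * Bp ≤ Ap * Bq :=
  le_of_tendsto_of_tendsto' (Tendsto.mul hAq hBp) (Tendsto.mul hAp hBq)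
    (sum_mul_sum_le_of_cross hab hpq)

/-- The denominators agree on both sides; what remains is x ^ (j - i) ≤ y ^ (j - i). -/
theorem pow_succ_div_cross {x y : ℝ} (hx : 0 ≤ x) (hxy : x ≤ y) (i j : ℕ) (hij : i ≤ j) :
    x ^ (j + 1) / ((j : ℝ) + 1) * (y ^ (i + 1) / ((i : ℝ) + 1)) ≤
      x ^ (i + 1) / ((i : ℝ) + 1) * (y ^ (j + 1) / ((j : ℝ) + 1)) := by
  obtain ⟨k, rfl⟩ := Nat.exists_eq_add_of_le hij
  have hy := hx.trans hxy
  have h : x ^ k ≤ y ^ k := pow_le_pow_left₀ hx hxy k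
  rw [div_mul_div_comm, div_mul_div_comm, mul_comm (((i : ℝ) + 1))]
  refine div_le_div_of_nonneg_right ?_ (by positivity)
  calc x ^ (i + k + 1) * y ^ (i + 1) = x ^ (i + 1) * y ^ (i + 1) * x ^ k := by ring
    _ ≤ x ^ (i + 1) * y ^ (i + 1) * y ^ k := by gcongr
    _ = _ := by ring

/-- The logarithm series `-log (1 - x) = ∑ x ^ (n + 1) / (n + 1)` on `(0, 1)`. -/
theorem hasSum_logSeries {x : ℝ} (hx : x ∈ Set.Ioo (0 : ℝ) 1) :
    HasSum (fun n : ℕ => x ^ (n + 1) / ((n : ℝ) + 1)) (-Real.log (1 - x)) :=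
  Real.hasSum_pow_div_log_of_abs_lt_one (abs_lt.2 ⟨by linarith [hx.1], hx.2⟩)

theorem logSeries_term_pos {x : ℝ} (hx : 0 < x) (n : ℕ) : 0 < x ^ (n + 1) / ((n : ℝ) + 1) := by
  positivity

theorem neg_log_one_sub_pos {x : ℝ} (hx : x ∈ Set.Ioo (0 : ℝ) 1) : 0 < -Real.log (1 - x) :=
  neg_pos.2 (Real.log_neg (by linarith [hx.2]) (by linarith [hx.1]))

theorem probSum_mem {x y : ℝ} (hx : x ∈ Set.Ioo (0 : ℝ) 1) (hy : y ∈ Set.Ioo (0 : ℝ) 1) :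
    x + y - x * y ∈ Set.Ioo (0 : ℝ) 1 ∧ x < x + y - x * y ∧ y < x + y - x * y := by
  obtain ⟨hx0, hx1⟩ := hx
  obtain ⟨hy0, hy1⟩ := hy
  refine ⟨⟨?_, ?_⟩, ?_, ?_⟩ <;> nlinarith [mul_pos hx0 hy0, mul_pos (sub_pos.2 hx1) (sub_pos.2 hy1)]

theorem neg_log_one_sub_probSum {x y : ℝ} (hx : x ∈ Set.Ioo (0 : ℝ) 1)
    (hy : y ∈ Set.Ioo (0 : ℝ) 1) :
    -Real.log (1 - (x + y - x * y)) = -Real.log (1 - x) + -Real.log (1 - y) := by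
  rw [show 1 - (x + y - x * y) = (1 - x) * (1 - y) by ring,
    Real.log_mul (by linarith [hx.2]) (by linarith [hy.2])]
  ring

/-! ### Logarithm series with monotone weights. -/

section WeightedLogSeries

variable {r : ℕ → ℝ} {g : ℝ → ℝ}

theorem weightedLog_pos (hr : ∀ n, 0 < r n)
    (hg : ∀ x ∈ Set.Ioo (0 : ℝ) 1, HasSum (fun n : ℕ => r n * (x ^ (n + 1) / ((n : ℝ) + 1))) (g x))
    {x : ℝ} (hx : x ∈ Set.Ioo (0 : ℝ) 1) : 0 < g x :=
  hasSum_lt (i := 0) (fun n => (mul_pos (hr n) (logSeries_term_pos hx.1 n)).le)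
    (mul_pos (hr 0) (logSeries_term_pos hx.1 0)) hasSum_zero (hg x hx)

theorem weightedLog_lt_of_lt (hr : ∀ n, 0 < r n)
    (hg : ∀ x ∈ Set.Ioo (0 : ℝ) 1, HasSum (fun n : ℕ => r n * (x ^ (n + 1) / ((n : ℝ) + 1))) (g x))
    {x y : ℝ} (hx : x ∈ Set.Ioo (0 : ℝ) 1) (hy : y ∈ Set.Ioo (0 : ℝ) 1) (hxy : x < y) :
    g x < g y := by
  have h (n : ℕ) : r n * (x ^ (n + 1) / ((n : ℝ) + 1)) < r n * (y ^ (n + 1) / ((n : ℝ) + 1)) := by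
    have h0 := hx.1.le
    have := hr n
    gcongr
  exact hasSum_lt (fun n => (h n).le) (h 0) (hg x hx) (hg y hy)

theorem weightedLog_lt_mul_log {M : ℝ} (hM : ∀ n, r n ≤ M) {k : ℕ} (hk : r k < M)
    (hg : ∀ x ∈ Set.Ioo (0 : ℝ) 1, HasSum (fun n : ℕ => r n * (x ^ (n + 1) / ((n : ℝ) + 1))) (g x))
    {x : ℝ} (hx : x ∈ Set.Ioo (0 : ℝ) 1) : g x < M * -Real.log (1 - x) :=
  hasSum_lt (fun n => mul_le_mul_of_nonneg_right (hM n) (logSeries_term_pos hx.1 n).le)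
    (mul_lt_mul_of_pos_right hk (logSeries_term_pos hx.1 k)) (hg x hx)
    ((hasSum_logSeries hx).mul_left M)

theorem mul_log_lt_weightedLog {m : ℝ} (hm : ∀ n, m ≤ r n) {k : ℕ} (hk : m < r k)
    (hg : ∀ x ∈ Set.Ioo (0 : ℝ) 1, HasSum (fun n : ℕ => r n * (x ^ (n + 1) / ((n : ℝ) + 1))) (g x))
    {x : ℝ} (hx : x ∈ Set.Ioo (0 : ℝ) 1) : m * -Real.log (1 - x) < g x :=
  hasSum_lt (fun n => mul_le_mul_of_nonneg_right (hm n) (logSeries_term_pos hx.1 n).le)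
    (mul_lt_mul_of_pos_right hk (logSeries_term_pos hx.1 k))
    ((hasSum_logSeries hx).mul_left m) (hg x hx)

theorem weightedLog_mul_log_le_of_antitone (hr : Antitone r)
    (hg : ∀ x ∈ Set.Ioo (0 : ℝ) 1, HasSum (fun n : ℕ => r n * (x ^ (n + 1) / ((n : ℝ) + 1))) (g x))
    {x y : ℝ} (hx : x ∈ Set.Ioo (0 : ℝ) 1) (hy : y ∈ Set.Ioo (0 : ℝ) 1) (hxy : x ≤ y) :
    g y * -Real.log (1 - x) ≤ g x * -Real.log (1 - y) :=
  hasSum_mul_le_of_cross (a := r) (b := fun _ => 1)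
    (fun i j hij => by simpa using hr hij)
    (pow_succ_div_cross hx.1.le hxy) (hg x hx) (hg y hy)
    (by simpa using hasSum_logSeries hx) (by simpa using hasSum_logSeries hy)

theorem weightedLog_mul_log_le_of_monotone (hr : Monotone r)
    (hg : ∀ x ∈ Set.Ioo (0 : ℝ) 1, HasSum (fun n : ℕ => r n * (x ^ (n + 1) / ((n : ℝ) + 1))) (g x))
    {x y : ℝ} (hx : x ∈ Set.Ioo (0 : ℝ) 1) (hy : y ∈ Set.Ioo (0 : ℝ) 1) (hxy : x ≤ y) :
    -Real.log (1 - y) * g x ≤ -Real.log (1 - x) * g y :=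
  hasSum_mul_le_of_cross (a := fun _ => 1) (b := r)
    (fun i j hij => by simpa using hr hij)
    (pow_succ_div_cross hx.1.le hxy)
    (by simpa using hasSum_logSeries hx) (by simpa using hasSum_logSeries hy) (hg x hx) (hg y hy)

theorem one_le_quotientQ_of_antitone (hr0 : ∀ n, 0 < r n) (hr : Antitone r)
    (hg : ∀ x ∈ Set.Ioo (0 : ℝ) 1, HasSum (fun n : ℕ => r n * (x ^ (n + 1) / ((n : ℝ) + 1))) (g x))
    {x y : ℝ} (hx : x ∈ Set.Ioo (0 : ℝ) 1) (hy : y ∈ Set.Ioo (0 : ℝ) 1) :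
    1 ≤ quotientQ g x y := by
  obtain ⟨hz, hxz, hyz⟩ := probSum_mem hx hy
  have h1 := weightedLog_mul_log_le_of_antitone hr hg hx hz hxz.le
  have h2 := weightedLog_mul_log_le_of_antitone hr hg hy hz hyz.le
  rw [quotientQ, one_le_div (weightedLog_pos hr0 hg hz)]
  refine le_of_mul_le_mul_right ?_ (neg_log_one_sub_pos hz)
  nth_rw 1 [neg_log_one_sub_probSum hx hy]
  linarith

theorem quotientQ_le_one_of_monotone (hr0 : ∀ n, 0 < r n) (hr : Monotone r)
    (hg : ∀ x ∈ Set.Ioo (0 : ℝ) 1, HasSum (fun n : ℕ => r n * (x ^ (n + 1) / ((n : ℝ) + 1))) (g x))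
    {x y : ℝ} (hx : x ∈ Set.Ioo (0 : ℝ) 1) (hy : y ∈ Set.Ioo (0 : ℝ) 1) :
    quotientQ g x y ≤ 1 := by
  obtain ⟨hz, hxz, hyz⟩ := probSum_mem hx hy
  have h1 := weightedLog_mul_log_le_of_monotone hr hg hx hz hxz.le
  have h2 := weightedLog_mul_log_le_of_monotone hr hg hy hz hyz.le
  rw [quotientQ, div_le_one (weightedLog_pos hr0 hg hz)]
  refine le_of_mul_le_mul_left ?_ (neg_log_one_sub_pos hz)
  nth_rw 2 [neg_log_one_sub_probSum hx hy]
  linarith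

theorem quotientQ_lt_two (hr : ∀ n, 0 < r n)
    (hg : ∀ x ∈ Set.Ioo (0 : ℝ) 1, HasSum (fun n : ℕ => r n * (x ^ (n + 1) / ((n : ℝ) + 1))) (g x))
    {x y : ℝ} (hx : x ∈ Set.Ioo (0 : ℝ) 1) (hy : y ∈ Set.Ioo (0 : ℝ) 1) :
    quotientQ g x y < 2 := by
  obtain ⟨hz, hxz, hyz⟩ := probSum_mem hx hy
  rw [quotientQ, div_lt_iff₀ (weightedLog_pos hr hg hz)]
  linarith [weightedLog_lt_of_lt hr hg hx hz hxz, weightedLog_lt_of_lt hr hg hy hz hyz]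

theorem quotientQ_lt_of_antitone {B : ℝ} (hB : 0 < B) {k : ℕ} (hr0 : ∀ n, 0 < r n) (hr : Antitone r)
    (h0 : r 0 = 1) (h1 : r k < r 0) (hlim : Tendsto r atTop (𝓝 (1 / B)))
    (hg : ∀ x ∈ Set.Ioo (0 : ℝ) 1, HasSum (fun n : ℕ => r n * (x ^ (n + 1) / ((n : ℝ) + 1))) (g x))
    {x y : ℝ} (hx : x ∈ Set.Ioo (0 : ℝ) 1) (hy : y ∈ Set.Ioo (0 : ℝ) 1) :
    quotientQ g x y < B := by
  have hz := (probSum_mem hx hy).1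
  have hle (n : ℕ) : r n ≤ 1 := h0 ▸ hr (Nat.zero_le n)
  have hge : ∀ n, 1 / B ≤ r n := hr.le_of_tendsto hlim
  have hx' := weightedLog_lt_mul_log hle (h0 ▸ h1) hg hx
  have hy' := weightedLog_lt_mul_log hle (h0 ▸ h1) hg hy
  have hz' := mul_log_lt_weightedLog hge ((hge k).trans_lt h1) hg hz
  rw [one_div_mul_eq_div, div_lt_iff₀' hB, neg_log_one_sub_probSum hx hy] at hz'
  rw [quotientQ, div_lt_iff₀ (weightedLog_pos hr0 hg hz)]
  linarith

theorem lt_quotientQ_of_monotone {B : ℝ} (hB : 0 < B) {k : ℕ} (hr0 : ∀ n, 0 < r n) (hr : Monotone r)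
    (h0 : r 0 = 1) (h1 : r 0 < r k) (hlim : Tendsto r atTop (𝓝 (1 / B)))
    (hg : ∀ x ∈ Set.Ioo (0 : ℝ) 1, HasSum (fun n : ℕ => r n * (x ^ (n + 1) / ((n : ℝ) + 1))) (g x))
    {x y : ℝ} (hx : x ∈ Set.Ioo (0 : ℝ) 1) (hy : y ∈ Set.Ioo (0 : ℝ) 1) :
    B < quotientQ g x y := by
  have hz := (probSum_mem hx hy).1
  have hge (n : ℕ) : 1 ≤ r n := h0 ▸ hr (Nat.zero_le n)
  have hle : ∀ n, r n ≤ 1 / B := hr.ge_of_tendsto hlim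
  have hx' := mul_log_lt_weightedLog hge (h0 ▸ h1) hg hx
  have hy' := mul_log_lt_weightedLog hge (h0 ▸ h1) hg hy
  have hz' := weightedLog_lt_mul_log hle (h1.trans_le (hle k)) hg hz
  rw [one_div_mul_eq_div, lt_div_iff₀' hB, neg_log_one_sub_probSum hx hy] at hz'
  rw [quotientQ, lt_div_iff₀ (weightedLog_pos hr0 hg hz)]
  linarith

end WeightedLogSeries

/-! ### Monotonicity and limit of the coefficient ratios. -/

/-- The ratio of the `n`-th Taylor coefficients of `F(c,d;c+d;x)` and `F(1,1;2;x)`. -/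
noncomputable def zeroBalancedRatio (c d : ℝ) (n : ℕ) : ℝ :=
  ordinaryHypergeometricCoefficient c d (c + d) n * (n + 1)

section ZeroBalancedRatio

variable {c d : ℝ}

theorem zeroBalancedRatio_zero : zeroBalancedRatio c d 0 = 1 := by
  simp [zeroBalancedRatio, ordinaryHypergeometricCoefficient]

theorem zeroBalancedRatio_pos (hc : 0 < c) (hd : 0 < d) (n : ℕ) :
    0 < zeroBalancedRatio c d n := by
  have h1 := ascPochhammer_pos n c hc
  have h2 := ascPochhammer_pos n d hd
  have h3 := ascPochhammer_pos n (c + d) (add_pos hc hd)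
  unfold zeroBalancedRatio ordinaryHypergeometricCoefficient
  positivity

/-- The numerator is affine in n, so the signs of its slope and of its value at 0 decide
monotonicity. -/
theorem zeroBalancedRatio_succ (hc : 0 < c) (hd : 0 < d) (n : ℕ) :
    zeroBalancedRatio c d (n + 1) = zeroBalancedRatio c d n *
      (1 + ((c * d - 1) * n + (2 * (c * d) - (c + d))) / ((c + d + n) * (n + 1) ^ 2)) := by
  have h3 := (ascPochhammer_pos n (c + d) (add_pos hc hd)).ne'
  have h4 : (n.factorial : ℝ) ≠ 0 := by positivity
  have h5 : c + d + n ≠ 0 := by positivity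
  have h6 : (n : ℝ) + 1 ≠ 0 := by positivity
  simp only [zeroBalancedRatio, ordinaryHypergeometricCoefficient, ascPochhammer_succ_eval,
    Nat.factorial_succ, Nat.cast_mul, Nat.cast_add, Nat.cast_one]
  field_simp
  ring

theorem zeroBalancedRatio_antitone (hc : 0 < c) (hd : 0 < d) (h1 : c * d ≤ 1)
    (h2 : 2 * (c * d) ≤ c + d) : Antitone (zeroBalancedRatio c d) := by
  refine antitone_nat_of_succ_le fun n => ?_
  rw [zeroBalancedRatio_succ hc hd]
  refine mul_le_of_le_one_right (zeroBalancedRatio_pos hc hd n).le ?_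
  have : ((c * d - 1) * n + (2 * (c * d) - (c + d))) / ((c + d + n) * (n + 1) ^ 2) ≤ 0 :=
    div_nonpos_of_nonpos_of_nonneg (add_nonpos
      (mul_nonpos_of_nonpos_of_nonneg (by linarith) n.cast_nonneg) (by linarith)) (by positivity)
  linarith

theorem zeroBalancedRatio_monotone (hc : 0 < c) (hd : 0 < d) (h1 : 1 ≤ c * d)
    (h2 : c + d ≤ 2 * (c * d)) : Monotone (zeroBalancedRatio c d) := by
  refine monotone_nat_of_le_succ fun n => ?_
  rw [zeroBalancedRatio_succ hc hd]
  refine le_mul_of_one_le_right (zeroBalancedRatio_pos hc hd n).le ?_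
  have : 0 ≤ ((c * d - 1) * n + (2 * (c * d) - (c + d))) / ((c + d + n) * (n + 1) ^ 2) :=
    div_nonneg (add_nonneg (mul_nonneg (by linarith) n.cast_nonneg) (by linarith)) (by positivity)
  linarith

theorem zeroBalancedRatio_two (hc : 0 < c) (hd : 0 < d) :
    zeroBalancedRatio c d 2 = zeroBalancedRatio c d 1 *
      (1 + (3 * (c * d) - 1 - (c + d)) / ((c + d + 1) * 4)) := by
  have h := zeroBalancedRatio_succ hc hd 1
  norm_num at h
  rw [h]
  ring

theorem zeroBalancedRatio_two_lt (hc : 0 < c) (hd : 0 < d) (h : 3 * (c * d) < 1 + (c + d)) :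
    zeroBalancedRatio c d 2 < zeroBalancedRatio c d 1 := by
  rw [zeroBalancedRatio_two hc hd]
  refine mul_lt_of_lt_one_right (zeroBalancedRatio_pos hc hd 1) ?_
  have : (3 * (c * d) - 1 - (c + d)) / ((c + d + 1) * 4) < 0 :=
    div_neg_of_neg_of_pos (by linarith) (by positivity)
  linarith

theorem lt_zeroBalancedRatio_two (hc : 0 < c) (hd : 0 < d) (h : 1 + (c + d) < 3 * (c * d)) :
    zeroBalancedRatio c d 1 < zeroBalancedRatio c d 2 := by
  rw [zeroBalancedRatio_two hc hd]
  refine lt_mul_of_one_lt_right (zeroBalancedRatio_pos hc hd 1) ?_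
  have : 0 < (3 * (c * d) - 1 - (c + d)) / ((c + d + 1) * 4) :=
    div_pos (by linarith) (by positivity)
  linarith

theorem ascPochhammer_succ_eq_div_gammaSeq {s : ℝ} (hs : 0 < s) {n : ℕ} (hn : n ≠ 0) :
    (ascPochhammer ℝ (n + 1)).eval s = (n : ℝ) ^ s * n.factorial / Real.GammaSeq s n := by
  have hprod : ∏ j ∈ Finset.range (n + 1), (s + (j : ℝ)) = (ascPochhammer ℝ (n + 1)).eval s := by
    generalize n + 1 = m
    induction m with
    | zero => simp
    | succ m ih => rw [Finset.prod_range_succ, ih, ascPochhammer_succ_eval]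
  have h1 := (ascPochhammer_pos (n + 1) s hs).ne'
  have h2 : (n : ℝ) ^ s ≠ 0 := (Real.rpow_pos_of_pos (by positivity) s).ne'
  have h3 : (n.factorial : ℝ) ≠ 0 := by positivity
  rw [Real.GammaSeq, hprod]
  field_simp

theorem tendsto_zeroBalancedRatio (hc : 0 < c) (hd : 0 < d) :
    Tendsto (zeroBalancedRatio c d) atTop (𝓝 (1 / ProbabilityTheory.beta c d)) := by
  -- `Real.GammaSeq s n` has n + 1 factors in its denominator, hence the shift; the factor 1 +
  -- 1/(n+1) below is (n+2)/(n+1).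
  rw [← tendsto_add_atTop_iff_nat 1]
  have hG : Tendsto (fun n => Real.GammaSeq (c + d) n /
      (Real.GammaSeq c n * Real.GammaSeq d n) * (1 + 1 / ((n : ℝ) + 1))) atTop
      (𝓝 (Real.Gamma (c + d) / (Real.Gamma c * Real.Gamma d) * (1 + 0))) :=
    ((Real.GammaSeq_tendsto_Gamma _).div
      ((Real.GammaSeq_tendsto_Gamma c).mul (Real.GammaSeq_tendsto_Gamma d))
      (mul_pos (Real.Gamma_pos_of_pos hc) (Real.Gamma_pos_of_pos hd)).ne').mul
      (tendsto_const_nhds.add tendsto_one_div_add_atTop_nhds_zero_nat)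
  rw [ProbabilityTheory.beta, one_div_div]
  rw [add_zero, mul_one] at hG
  refine hG.congr' ?_
  filter_upwards [eventually_ne_atTop 0] with n hn
  have hn0 : (0 : ℝ) < n := by positivity
  have h1 : (n : ℝ) ^ c ≠ 0 := (Real.rpow_pos_of_pos hn0 c).ne'
  have h2 : (n : ℝ) ^ d ≠ 0 := (Real.rpow_pos_of_pos hn0 d).ne'
  have h3 : (n.factorial : ℝ) ≠ 0 := by positivity
  have h4 : (n : ℝ) + 1 ≠ 0 := by positivity
  simp only [zeroBalancedRatio, ordinaryHypergeometricCoefficient,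
    ascPochhammer_succ_eq_div_gammaSeq hc hn, ascPochhammer_succ_eq_div_gammaSeq hd hn,
    ascPochhammer_succ_eq_div_gammaSeq (add_pos hc hd) hn, Real.rpow_add hn0,
    Nat.factorial_succ, Nat.cast_mul, Nat.cast_add, Nat.cast_one, inv_div]
  field_simp

theorem hasSum_zeroBalancedG (hc : 0 < c) (hd : 0 < d) {x : ℝ} (hx : x ∈ Set.Ioo (0 : ℝ) 1) :
    HasSum (fun n : ℕ => zeroBalancedRatio c d n * (x ^ (n + 1) / ((n : ℝ) + 1)))
      (zeroBalancedG c d x) := by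
  have hterm (n : ℕ) : zeroBalancedRatio c d n * (x ^ (n + 1) / ((n : ℝ) + 1)) =
      x * (ordinaryHypergeometricCoefficient c d (c + d) n • x ^ n) := by
    have : (n : ℝ) + 1 ≠ 0 := by positivity
    rw [zeroBalancedRatio, smul_eq_mul]
    field_simp
    ring
  obtain ⟨M, hM⟩ := (tendsto_zeroBalancedRatio hc hd).bddAbove_range
  -- A convergent r is bounded, so a multiple of the logarithm series dominates.
  have hsum : Summable fun n : ℕ => zeroBalancedRatio c d n * (x ^ (n + 1) / ((n : ℝ) + 1)) :=
    Summable.of_nonneg_of_le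
      (fun n => (mul_pos (zeroBalancedRatio_pos hc hd n) (logSeries_term_pos hx.1 n)).le)
      (fun n => mul_le_mul_of_nonneg_right (hM ⟨n, rfl⟩) (logSeries_term_pos hx.1 n).le)
      ((hasSum_logSeries hx).mul_left M).summable
  have := hsum.hasSum
  simp_rw [hterm] at this ⊢
  rwa [tsum_mul_left, ← ordinaryHypergeometric_sum_eq] at this

end ZeroBalancedRatio

theorem mainTheorem5 (c d : ℝ) (hc : 0 < c) (hd : 0 < d) :
    (c * d ≤ 1 → ∀ x ∈ Set.Ioo (0 : ℝ) 1, ∀ y ∈ Set.Ioo (0 : ℝ) 1,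
      1 ≤ quotientQ (zeroBalancedG c d) x y ∧
      ((c, d) ≠ (1, 1) →
        quotientQ (zeroBalancedG c d) x y < min (ProbabilityTheory.beta c d) 2)) ∧
    (1 / c + 1 / d ≤ 2 → ∀ x ∈ Set.Ioo (0 : ℝ) 1, ∀ y ∈ Set.Ioo (0 : ℝ) 1,
      ((c, d) ≠ (1, 1) →
        ProbabilityTheory.beta c d < quotientQ (zeroBalancedG c d) x y) ∧
      quotientQ (zeroBalancedG c d) x y ≤ 1) := by
  have hB := ProbabilityTheory.beta_pos hc hd
  have hpos := zeroBalancedRatio_pos hc hd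
  have hlim := tendsto_zeroBalancedRatio hc hd
  have hg := fun x (hx : x ∈ Set.Ioo (0 : ℝ) 1) => hasSum_zeroBalancedG hc hd hx
  have hamgm : 4 * (c * d) ≤ (c + d) ^ 2 := by nlinarith [sq_nonneg (c - d)]
  have hone (h1 : c * d = 1) (h2 : c + d = 2) : (c, d) = (1, 1) := by
    have hsq : (c - 1) ^ 2 = 0 := by rw [eq_sub_of_add_eq' h2] at h1; linarith
    have hc1 : c = 1 := sub_eq_zero.1 (pow_eq_zero_iff two_ne_zero |>.1 hsq)
    rw [Prod.mk.injEq]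
    exact ⟨hc1, by linarith⟩
  refine ⟨fun h x hx y hy => ?_, fun h x hx y hy => ?_⟩
  · have hsum : 2 * (c * d) ≤ c + d := by
      refine (sq_le_sq₀ (by positivity) (by positivity)).1 ?_
      -- 4(cd)² ≤ 4cd ≤ (c + d)².
      nlinarith [mul_pos hc hd]
    have hanti := zeroBalancedRatio_antitone hc hd h hsum
    refine ⟨one_le_quotientQ_of_antitone hpos hanti hg hx hy, fun hne => lt_min ?_ ?_⟩
    · refine quotientQ_lt_of_antitone hB hpos hanti zeroBalancedRatio_zero (k := 2) ?_ hlim hg hx hy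
      refine (zeroBalancedRatio_two_lt hc hd ?_).trans_le (hanti zero_le_one)
      -- Otherwise 1 + (c + d) ≤ 3cd ≤ 1 + (c + d), forcing cd = 1 and c + d = 2.
      by_contra! hcon
      exact hne (hone (by linarith) (by linarith))
    · exact quotientQ_lt_two hpos hg hx hy
  · have hsum : c + d ≤ 2 * (c * d) := by
      rw [div_add_div _ _ hc.ne' hd.ne', div_le_iff₀ (mul_pos hc hd)] at h
      linarith
    have hprod : 1 ≤ c * d := by
      have hcd := mul_pos hc hd
      -- 4cd ≤ (c + d)² ≤ 4(cd)²; cancel 4cd.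
      nlinarith [mul_le_mul hsum hsum (by positivity) (by positivity)]
    have hmono := zeroBalancedRatio_monotone hc hd hprod hsum
    refine ⟨fun hne => ?_, quotientQ_le_one_of_monotone hpos hmono hg hx hy⟩
    -- Index 1 would not do: r 1 = r 0 whenever c + d = 2cd, which also happens away from (1, 1).
    refine lt_quotientQ_of_monotone hB hpos hmono zeroBalancedRatio_zero (k := 2) ?_ hlim hg hx hy
    refine (hmono zero_le_one).trans_lt (lt_zeroBalancedRatio_two hc hd ?_)
    by_contra! hcon
    exact hne (hone (by linarith) (by linarith))
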